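/- For a rational number $x=p/q$ in lowest terms let $h(x)=\log\max\{|p|,|q|\}$ be its logarithmic height. For $F\in\mathbb{Q}(X)$, written $F=P/Q$ with $P,Q\in\mathbb{Q}[X]$ coprime, the degree of $F$ is $\max\{\deg P,\deg Q\}$ (and $0$ if $F=0$), and $h(F)$ is the logarithmic Weil height of the projective point whose coordinates are all the coefficients of $P$ and $Q$; equivalently, if $P,Q$ are scaled so that all their coefficients are integers with no common prime factor, $h(F)$ is the maximum of $\log|a|$ over the nonzero coefficients $a$ of $P$ and $Q$. Let $c\geq 1$ be a real number, let $d\geq 1$ be an integer, and let $F\in\mathbb{Q}(X)$ be a rational fraction of degree at most $d$. Let $V\subset\mathbb{Z}$ be a finite set such that $F$ has no poles in $\mathbb{Z}\setminus V$. Assume that for every $x\in\mathbb{Z}\setminus V$, $$h(F(x))\leq c\,\max\{1,\ d\log d+d\,h(x)\}.$$ Then $$h(F)\leq C\,d\log(4d),\qquad\text{where}\quad C=(4c+1923)\bigl(12+\log\max\{1,\#V\}+2\log c\bigr).$$ -/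

import Mathlib

namespace RationalFraction

/-- The degree of a univariate rational fraction `F = P / Q` in lowest terms:
`max (deg P) (deg Q)`. -/
noncomputable def degree (F : RatFunc ℚ) : ℕ :=
  max F.num.natDegree F.denom.natDegree

/-- `x` is a pole of `F = P / Q` (in lowest terms) if `Q(x) = 0`. -/
def IsPole (F : RatFunc ℚ) (x : ℚ) : Prop :=
  F.denom.IsRoot x

/-- The value `F(x) = P(x) / Q(x)`; used only at points `x` that are not poles of `F`. -/
noncomputable def value (F : RatFunc ℚ) (x : ℚ) : ℚ :=
  F.eval (RingHom.id ℚ) x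

/-- The tuple formed by all the coefficients of `P` and `Q`, where `F = P / Q` in lowest terms. -/
noncomputable def coeffTuple (F : RatFunc ℚ) :
    Fin (F.num.natDegree + 1) ⊕ Fin (F.denom.natDegree + 1) → ℚ :=
  Sum.elim (fun i => F.num.coeff i) (fun j => F.denom.coeff j)

/-- The logarithmic Weil height of a rational fraction `F = P / Q` over `ℚ` in lowest terms: the
logarithmic height of the projective point given by all the coefficients of `P` and `Q`.
(Over `ℚ` the absolute height is Mathlib's `Height.logHeight`, as `[ℚ : ℚ] = 1`.) -/
noncomputable def height (F : RatFunc ℚ) : ℝ :=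
  Height.logHeight (coeffTuple F)

end RationalFraction

/-! Write `F = P / Q` with integral, jointly primitive `P`, `Q` and largest coefficient `M`, so that
`h(F) = log M`. The proof compares two estimates for the product of `gcd(P(x), Q(x))` over the
admissible integers `x` of `[1, N]`. Lower bound: `max(|P(x)|, |Q(x)|)` is at most `exp (h(F(x)))`
times this gcd, and by Lagrange interpolation the polynomial carrying the coefficient `±M` is small
at no more than `d` integers (`card_filter_abs_eval_lt_le`). So the gcd is nearly as large as `M` at
all but `d` points. Upper bound: each gcd divides a nonzero integer `R` with `log R` about `2 d log
M` (`exists_gcd_eval_dvd`). Using this at every point would lose too much, but a primitive pair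
cannot have highly `p`-divisible values at many points: the whole product divides `(R * N!²) ^ d`
(`prod_gcd_eval_dvd`), which costs about `2 d² log M` however many points there are. With at least
`10 d²` points the lower bound wins, and `log M` is bounded. -/

/-! ### Prime by prime: common divisors of values of a primitive pair. -/

/-- Distinct integers of `[1, N]` other than `a` have differences with `a` whose product divides
`(N !)²`. -/
theorem prod_natAbs_sub_dvd_factorial_sq {N : ℕ} {a : ℤ} (ha : a ∈ Finset.Icc (1 : ℤ) N)
    {T : Finset ℤ} (hT : T ⊆ Finset.Icc (1 : ℤ) N) (haT : a ∉ T) :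
    ∏ x ∈ T, (x - a).natAbs ∣ (N.factorial) ^ 2 := by
  have key : ∀ U ⊆ T, Set.InjOn (fun x : ℤ => (x - a).natAbs) U →
      ∏ x ∈ U, (x - a).natAbs ∣ N.factorial := by
    intro U hU hinj
    rw [← Finset.prod_Ico_id_eq_factorial,
      ← Finset.prod_image (f := fun n : ℕ => n) (g := fun x : ℤ => (x - a).natAbs) hinj]
    refine Finset.prod_dvd_prod_of_subset _ _ _ fun n hn => ?_
    obtain ⟨x, hx, rfl⟩ := Finset.mem_image.1 hn
    have hxa : x ≠ a := fun h => haT (h ▸ hU hx)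
    have := Finset.mem_Icc.1 (hT (hU hx))
    have := Finset.mem_Icc.1 ha
    rw [Finset.mem_Ico]
    omega
  -- `|x - a|` is injective on each side of `a`, so each side contributes a divisor of `N!`; hence
  -- the square.
  rw [← Finset.prod_filter_mul_prod_filter_not T (fun x => x < a), sq]
  refine mul_dvd_mul (key _ (Finset.filter_subset _ _) ?_) (key _ (Finset.filter_subset _ _) ?_)
  · intro x hx y hy hxy
    simp only [Finset.coe_filter, Set.mem_ofPred_eq] at hx hy hxy
    omega
  · intro x hx y hy hxy
    simp only [Finset.coe_filter, Set.mem_ofPred_eq] at hx hy hxy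
    omega

theorem pow_sub_padicValInt_dvd {p : ℕ} [Fact p.Prime] {a b : ℤ} {k : ℕ} (ha : a ≠ 0)
    (h : (p : ℤ) ^ k ∣ a * b) : (p : ℤ) ^ (k - padicValInt p a) ∣ b := by
  by_cases hb : b = 0
  · simp [hb]
  rw [padicValInt_dvd_iff] at h ⊢
  right
  have h := h.resolve_left (mul_ne_zero ha hb)
  rw [padicValInt.mul ha hb] at h
  omega

open Polynomial in
/-- If a polynomial `P` of degree at most `d` is not divisible by the prime `p`, then its values
on `[1, N]` cannot be divisible by large powers of `p` on average, up to `d` exceptions. -/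
theorem sum_le_of_pow_dvd_eval {p : ℕ} [Fact p.Prime] (N M : ℕ) (d : ℕ) :
    ∀ (P : ℤ[X]), P.natDegree ≤ d → ¬ C (p : ℤ) ∣ P →
    ∀ (S : Finset ℤ), S ⊆ Finset.Icc (1 : ℤ) N → ∀ w : ℤ → ℕ,
      (∀ x ∈ S, (p : ℤ) ^ w x ∣ P.eval x) → (∀ x ∈ S, w x ≤ M) →
      ∑ x ∈ S, w x ≤ d * (M + padicValNat p ((N.factorial) ^ 2)) := by
  induction d with
  | zero =>
    intro P hP hp S _ w hw _
    rw [zero_mul, Nat.le_zero, Finset.sum_eq_zero_iff]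
    intro x hx
    by_contra h0
    have h := (dvd_pow_self (p : ℤ) h0).trans (hw x hx)
    rw [eq_C_of_natDegree_le_zero hP] at hp h
    rw [eval_C] at h
    exact hp (map_dvd C h)
  | succ d ih =>
    intro P hP hp S hS w hw hM
    obtain rfl | hne := S.eq_empty_or_nonempty
    · simp
    -- Maximality of `w a` makes `P(a)` divisible by every `p ^ w x`, hence so is `P(x) - P(a) = (x
    -- - a) P₁(x)`. Passing to `P₁` costs at most `M` for the point `a`, plus the valuation of the
    -- product of the `x - a`.
    obtain ⟨a, haS, hmax⟩ := S.exists_max_image w hne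
    by_cases hwa : w a = 0
    · rw [Finset.sum_eq_zero fun x hx => Nat.le_zero.1 (hwa ▸ hmax x hx)]
      exact Nat.zero_le _
    set P₁ : ℤ[X] := P /ₘ (X - C a) with hP₁
    have hdecomp : P = C (P.eval a) + (X - C a) * P₁ := by
      rw [← modByMonic_X_sub_C_eq_C_eval]
      exact (modByMonic_add_div P _).symm
    have hpa : (p : ℤ) ∣ P.eval a := (dvd_pow_self (p : ℤ) hwa).trans (hw a haS)
    have hdeg : P₁.natDegree ≤ d := by
      rw [hP₁, natDegree_divByMonic P (monic_X_sub_C a), natDegree_X_sub_C]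
      omega
    -- This uses `p ∣ P(a)`, which is why the case `w a = 0` was split off.
    have hp₁ : ¬ C (p : ℤ) ∣ P₁ := fun h =>
      hp (hdecomp ▸ dvd_add (map_dvd C hpa) (h.mul_left _))
    have hsub : ∀ x ∈ S.erase a, (p : ℤ) ^ (w x - padicValInt p (x - a)) ∣ P₁.eval x := by
      intro x hx
      obtain ⟨hxa, hxS⟩ := Finset.mem_erase.1 hx
      refine pow_sub_padicValInt_dvd (sub_ne_zero.2 hxa) ?_
      have h1 : (x - a) * P₁.eval x = P.eval x - P.eval a := by
        conv_rhs => rw [hdecomp]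
        simp
      rw [h1]
      exact dvd_sub (hw x hxS) ((pow_dvd_pow _ (hmax x hxS)).trans (hw a haS))
    have hrec := ih P₁ hdeg hp₁ (S.erase a) ((Finset.erase_subset _ _).trans hS) _ hsub
      fun x hx => (Nat.sub_le _ _).trans (hM x (Finset.mem_of_mem_erase hx))
    have hval : ∑ x ∈ S.erase a, padicValInt p (x - a) ≤ padicValNat p ((N.factorial) ^ 2) := by
      have hne0 : ∀ x ∈ S.erase a, (x - a).natAbs ≠ 0 := fun x hx =>
        Int.natAbs_ne_zero.2 (sub_ne_zero.2 (Finset.ne_of_mem_erase hx))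
      have h2 : ∑ x ∈ S.erase a, padicValInt p (x - a)
          = padicValNat p (∏ x ∈ S.erase a, (x - a).natAbs) := by
        simp only [← Nat.factorization_def _ (Fact.out : p.Prime), padicValInt]
        rw [Nat.factorization_prod hne0, Finset.sum_apply']
      rw [h2]
      refine (padicValNat_dvd_iff_le (pow_ne_zero _ N.factorial_ne_zero)).1
        (pow_padicValNat_dvd.trans ?_)
      exact prod_natAbs_sub_dvd_factorial_sq (hS haS) ((Finset.erase_subset _ _).trans hS)
        (Finset.notMem_erase _ _)
    have hsplit : ∑ x ∈ S.erase a, w x ≤ ∑ x ∈ S.erase a, (w x - padicValInt p (x - a))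
        + ∑ x ∈ S.erase a, padicValInt p (x - a) := by
      rw [← Finset.sum_add_distrib]
      exact Finset.sum_le_sum fun x _ => by omega
    rw [← Finset.add_sum_erase S w haS]
    have := hM a haS
    rw [Nat.succ_mul]
    omega

open Polynomial in
/-- The product of the greatest common divisors of the values of two jointly primitive
polynomials. -/
theorem prod_gcd_eval_dvd {P Q : ℤ[X]} {d : ℕ} (hP : P.natDegree ≤ d) (hQ : Q.natDegree ≤ d)
    (hprim : ∀ p : ℕ, p.Prime → ¬ (C (p : ℤ) ∣ P ∧ C (p : ℤ) ∣ Q)) {R : ℕ} (hR : R ≠ 0)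
    {N : ℕ} {S : Finset ℤ} (hS : S ⊆ Finset.Icc (1 : ℤ) N)
    (hgcd : ∀ x ∈ S, Int.gcd (P.eval x) (Q.eval x) ∣ R) :
    ∏ x ∈ S, Int.gcd (P.eval x) (Q.eval x) ∣ (R * (N.factorial) ^ 2) ^ d := by
  have hne : ∀ x ∈ S, Int.gcd (P.eval x) (Q.eval x) ≠ 0 := fun x hx =>
    ne_zero_of_dvd_ne_zero hR (hgcd x hx)
  have hfac : (N.factorial) ^ 2 ≠ 0 := pow_ne_zero _ N.factorial_ne_zero
  rw [← Nat.factorization_prime_le_iff_dvd (Finset.prod_ne_zero_iff.2 hne)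
    (pow_ne_zero _ (mul_ne_zero hR hfac))]
  intro p hp
  have : Fact p.Prime := ⟨hp⟩
  rw [Nat.factorization_prod hne, Finset.sum_apply', Nat.factorization_pow,
    Nat.factorization_mul hR hfac]
  simp only [Finsupp.smul_apply, Finsupp.add_apply, smul_eq_mul, Nat.factorization_def _ hp]
  have hdvd : ∀ x ∈ S, (p : ℤ) ^ padicValNat p (Int.gcd (P.eval x) (Q.eval x)) ∣
      (Int.gcd (P.eval x) (Q.eval x) : ℤ) := fun x _ => by
    exact_mod_cast pow_padicValNat_dvd
  have hle : ∀ x ∈ S, padicValNat p (Int.gcd (P.eval x) (Q.eval x)) ≤ padicValNat p R :=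
    fun x hx => (padicValNat_dvd_iff_le hR).1 (pow_padicValNat_dvd.trans (hgcd x hx))
  -- One of the two polynomials is nonzero modulo `p`, and the gcd divides its values.
  by_cases h : C (p : ℤ) ∣ P
  · exact sum_le_of_pow_dvd_eval N _ d Q hQ (fun h' => hprim p hp ⟨h, h'⟩) S hS _
      (fun x hx => (hdvd x hx).trans (Int.gcd_dvd_right _ _)) hle
  · exact sum_le_of_pow_dvd_eval N _ d P hP h S hS _
      (fun x hx => (hdvd x hx).trans (Int.gcd_dvd_left _ _)) hle
-- The resultant as a uniform multiple of the gcds.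
open Polynomial in
/-- A nonzero integer of controlled size in the ideal generated by two coprime polynomials. -/
theorem exists_gcd_eval_dvd {P Q : ℤ[X]} {d M : ℕ} (hd : 1 ≤ d) (hM : 1 ≤ M)
    (hPd : P.natDegree ≤ d) (hQd : Q.natDegree ≤ d)
    (hP : ∀ n, |P.coeff n| ≤ M) (hQ : ∀ n, |Q.coeff n| ≤ M)
    (hcop : IsCoprime (P.map (Int.castRingHom ℚ)) (Q.map (Int.castRingHom ℚ))) :
    ∃ R : ℕ, R ≠ 0 ∧ R ≤ (2 * d).factorial * M ^ (2 * d) ∧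
      ∀ x : ℤ, Int.gcd (P.eval x) (Q.eval x) ∣ R := by
  have hone : M ≤ (2 * d).factorial * M ^ (2 * d) :=
    (Nat.le_self_pow (by omega) M).trans (Nat.le_mul_of_pos_left _ (Nat.factorial_pos _))
  -- The resultant identity needs a positive degree; for two constants, a nonzero one serves as `R`.
  by_cases hdeg : P.natDegree = 0 ∧ Q.natDegree = 0
  · have hPC := eq_C_of_natDegree_eq_zero hdeg.1
    have hQC := eq_C_of_natDegree_eq_zero hdeg.2
    have hval : ∀ x, P.eval x = P.coeff 0 ∧ Q.eval x = Q.coeff 0 := fun x =>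
      ⟨by conv_lhs => rw [hPC, eval_C], by conv_lhs => rw [hQC, eval_C]⟩
    by_cases h0 : P.coeff 0 = 0
    · have hQ0 : Q.coeff 0 ≠ 0 := by
        intro h1
        rw [hPC, hQC, h0, h1] at hcop
        simp [isCoprime_zero_left] at hcop
      refine ⟨(Q.coeff 0).natAbs, by simpa using hQ0, le_trans ?_ hone, fun x => ?_⟩
      · zify; exact hQ 0
      · rw [(hval x).2]; exact Int.gcd_dvd_natAbs_right _ _
    · refine ⟨(P.coeff 0).natAbs, by simpa using h0, le_trans ?_ hone, fun x => ?_⟩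
      · zify; exact hP 0
      · rw [(hval x).1]; exact Int.gcd_dvd_natAbs_left _ _
  · obtain ⟨U, W, -, -, hUW⟩ := exists_mul_add_mul_eq_C_resultant P Q le_rfl le_rfl
      (not_and_or.1 hdeg)
    have hinj : Function.Injective (Int.castRingHom ℚ) := Int.cast_injective
    refine ⟨(resultant P Q).natAbs, ?_, ?_, fun x => ?_⟩
    · have h := resultant_ne_zero _ _ hcop
      rw [natDegree_map_eq_of_injective hinj, natDegree_map_eq_of_injective hinj,
        resultant_map_map] at h
      intro h0
      rw [Int.natAbs_eq_zero.1 h0] at h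
      simp at h
    -- The Sylvester matrix has size at most `2 d` and entries bounded by `M`.
    · have hdet := Matrix.det_le (A := sylvester P Q P.natDegree Q.natDegree)
        (abv := AbsoluteValue.abs) (x := (M : ℤ)) (by
          intro i j
          induction j using Fin.addCases with
          | left j =>
            simp only [sylvester, Matrix.of_apply, Fin.addCases_left, AbsoluteValue.abs_apply]
            split_ifs
            · exact hQ _
            · simp
          | right j =>
            simp only [sylvester, Matrix.of_apply, Fin.addCases_right, AbsoluteValue.abs_apply]
            split_ifs
            · exact hP _
            · simp)
      have h1 : (resultant P Q).natAbs ≤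
          (P.natDegree + Q.natDegree).factorial * M ^ (P.natDegree + Q.natDegree) := by
        zify
        simpa [resultant, nsmul_eq_mul] using hdet
      refine h1.trans (Nat.mul_le_mul (Nat.factorial_le (by omega))
        (Nat.pow_le_pow_right hM (by omega)))
    · have h := congrArg (eval x) hUW
      rw [eval_add, eval_mul, eval_mul, eval_C] at h
      rw [← Int.natCast_dvd, ← h]
      exact dvd_add ((Int.gcd_dvd_left _ _).mul_right _) ((Int.gcd_dvd_right _ _).mul_right _)
-- Absolute values: coefficients bounded through interpolation.
-- Each factor `(X - y) / (a - y)` enlarges the coefficients at most `N + 1` times: `1` from the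
-- shift by `X`, `N` from `y`, and nothing from the denominator.
open Polynomial in
theorem abs_coeff_prod_basisDivisor_le {N : ℕ} (a : ℚ) (T : Finset ℚ)
    (hT : ∀ y ∈ T, |y| ≤ N ∧ 1 ≤ |a - y|) (n : ℕ) :
    |(∏ y ∈ T, Lagrange.basisDivisor a y).coeff n| ≤ ((N : ℚ) + 1) ^ T.card := by
  induction T using Finset.induction_on generalizing n with
  | empty =>
    rw [Finset.prod_empty, coeff_one]
    split_ifs <;> simp
  | insert y T hy ih =>
    have ih := ih fun z hz => hT z (Finset.mem_insert_of_mem hz)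
    obtain ⟨hy1, hy2⟩ := hT y (Finset.mem_insert_self _ _)
    rw [Finset.prod_insert hy, Finset.card_insert_of_notMem hy, pow_succ', Lagrange.basisDivisor,
      mul_assoc, coeff_C_mul, abs_mul]
    generalize ∏ z ∈ T, Lagrange.basisDivisor a z = g at ih ⊢
    have hB0 : (0 : ℚ) ≤ ((N : ℚ) + 1) ^ T.card := by positivity
    generalize ((N : ℚ) + 1) ^ T.card = B at ih hB0 ⊢
    have hinv : |(a - y)⁻¹| ≤ 1 := by
      rw [abs_inv]
      exact inv_le_one_of_one_le₀ hy2
    have hmul : |((X - C y) * g).coeff n| ≤ ((N : ℚ) + 1) * B := by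
      rw [sub_mul, coeff_sub, coeff_C_mul]
      have h1 : |(X * g).coeff n| ≤ B := by
        cases n with
        | zero => rw [coeff_X_mul_zero, abs_zero]; exact hB0
        | succ n => rw [coeff_X_mul]; exact ih n
      have h2 : |y * g.coeff n| ≤ N * B := by
        rw [abs_mul]
        exact mul_le_mul hy1 (ih n) (abs_nonneg _) (Nat.cast_nonneg _)
      rw [abs_le] at h1 h2 ⊢
      constructor <;> linarith
    exact (mul_le_of_le_one_left (abs_nonneg _) hinv).trans hmul

open Polynomial in
/-- The coefficients of a polynomial of degree at most `d` are controlled by its values at `d + 1`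
integers of `[1, N]`. -/
theorem abs_coeff_le_of_abs_eval_le {P : ℤ[X]} {d N : ℕ} (hP : P.natDegree ≤ d)
    {T : Finset ℤ} (hT : T ⊆ Finset.Icc (1 : ℤ) N) (hcard : T.card = d + 1) {B : ℚ}
    (hB : ∀ x ∈ T, |((P.eval x : ℤ) : ℚ)| ≤ B) (n : ℕ) :
    |(P.coeff n : ℚ)| ≤ (d + 1) * (B * ((N : ℚ) + 1) ^ d) := by
  set f : ℚ[X] := P.map (Int.castRingHom ℚ) with hf
  set s : Finset ℚ := T.map ⟨((↑) : ℤ → ℚ), Int.cast_injective⟩ with hs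
  have hscard : s.card = d + 1 := by rw [hs, Finset.card_map, hcard]
  have hmem : ∀ y ∈ s, ∃ x ∈ T, (x : ℚ) = y := fun y hy => by
    simpa [hs] using hy
  have hdeg : f.degree < s.card := by
    rw [hscard]
    refine (degree_le_natDegree).trans_lt ?_
    have : f.natDegree ≤ d := natDegree_map_le.trans hP
    exact_mod_cast Nat.lt_succ_of_le this
  have hint : f = Lagrange.interpolate s id fun y => f.eval y :=
    Lagrange.eq_interpolate Function.injective_id.injOn hdeg
  have hcoeff : (P.coeff n : ℚ) = f.coeff n := by simp [hf]
  have hterm : ∀ y ∈ s, |(C (f.eval y) * Lagrange.basis s id y).coeff n| ≤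
      B * ((N : ℚ) + 1) ^ d := by
    intro y hy
    rw [coeff_C_mul, abs_mul]
    obtain ⟨x, hx, rfl⟩ := hmem y hy
    have h1 : |f.eval (x : ℚ)| ≤ B := by
      have := hB x hx
      rwa [hf, eval_intCast_map]
    refine mul_le_mul h1 ?_ (abs_nonneg _) ((abs_nonneg _).trans h1)
    have hc : (s.erase (x : ℚ)).card = d := by rw [Finset.card_erase_of_mem hy, hscard]; rfl
    rw [← hc]
    refine abs_coeff_prod_basisDivisor_le (x : ℚ) (s.erase (x : ℚ)) (fun z hz => ?_) n
    obtain ⟨hzx, hzs⟩ := Finset.mem_erase.1 hz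
    obtain ⟨t, ht, rfl⟩ := hmem z hzs
    have htx : x - t ≠ 0 := fun h => hzx (by rw [sub_eq_zero.1 h])
    have ht' := Finset.mem_Icc.1 (hT ht)
    refine ⟨?_, ?_⟩
    · rw [abs_of_nonneg (by exact_mod_cast (zero_le_one.trans ht'.1))]
      exact_mod_cast ht'.2
    · exact_mod_cast Int.one_le_abs htx
  rw [hcoeff, hint, Lagrange.interpolate_apply, finsetSum_coeff]
  calc _ ≤ ∑ y ∈ s, |(C (f.eval y) * Lagrange.basis s id y).coeff n| :=
        Finset.abs_sum_le_sum_abs _ _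
    _ ≤ s.card • (B * ((N : ℚ) + 1) ^ d) := Finset.sum_le_card_nsmul _ _ _ hterm
    _ = _ := by rw [hscard, nsmul_eq_mul]; push_cast; ring

open Polynomial in
/-- A polynomial of degree at most `d` takes small values at no more than `d` integers of
`[1, N]`. -/
theorem card_filter_abs_eval_lt_le {P : ℤ[X]} {d N : ℕ} (hP : P.natDegree ≤ d) {M : ℕ}
    {n : ℕ} (hn : |P.coeff n| = M) {S : Finset ℤ} (hS : S ⊆ Finset.Icc (1 : ℤ) N) :
    (S.filter fun x => (d + 1) * ((N : ℤ) + 1) ^ d * |P.eval x| < M).card ≤ d := by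
  by_contra! hlt
  obtain ⟨T, hTS, hcard⟩ := Finset.exists_subset_card_eq (Nat.succ_le_of_lt hlt)
  set K : ℤ := (d + 1) * ((N : ℤ) + 1) ^ d with hK
  have hKpos : (0 : ℚ) < K := by rw [hK]; positivity
  have hmem : ∀ x ∈ T, K * |P.eval x| ≤ M - 1 := fun x hx => by
    have := (Finset.mem_filter.1 (hTS hx)).2
    omega
  -- By integrality the strict bound is `M - 1`, so interpolation at `d + 1` such points would give
  -- `M ≤ M - 1`.
  have h := abs_coeff_le_of_abs_eval_le hP
    (hTS.trans ((Finset.filter_subset _ _).trans hS)) hcard (B := ((M : ℚ) - 1) / K) (by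
      intro x hx
      rw [le_div_iff₀ hKpos, mul_comm]
      exact_mod_cast hmem x hx) n
  have h1 : ((d : ℚ) + 1) * (((M : ℚ) - 1) / K * ((N : ℚ) + 1) ^ d) = M - 1 := by
    have : (K : ℚ) = (d + 1) * ((N : ℚ) + 1) ^ d := by rw [hK]; push_cast; ring
    rw [div_mul_eq_mul_div, mul_div_assoc', div_eq_iff hKpos.ne', this]
    ring
  have h2 : |(P.coeff n : ℚ)| = M := by exact_mod_cast congrArg (Int.cast : ℤ → ℚ) hn
  rw [h1, h2] at h
  linarith

/-! ### Integral models and heights. -/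

/-- The entries of a nonzero rational tuple become coprime integers after scaling. -/
theorem exists_smul_eq_intCast_gcd_eq_one {ι : Type*} [Fintype ι] {x : ι → ℚ} (hx : x ≠ 0) :
    ∃ (k : ℚ) (y : ι → ℤ), k ≠ 0 ∧ Finset.univ.gcd y = 1 ∧ k • x = ((↑) : ℤ → ℚ) ∘ y := by
  obtain ⟨b, hb⟩ := IsLocalization.exist_integer_multiples_of_finset (nonZeroDivisors ℤ)
    (Finset.univ.image x)
  have hb0 : ((b : ℤ) : ℚ) ≠ 0 := by exact_mod_cast nonZeroDivisors.coe_ne_zero b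
  have hz : ∀ i, ∃ n : ℤ, (n : ℚ) = (b : ℤ) * x i := fun i => by
    obtain ⟨n, hn⟩ := hb (x i) (Finset.mem_image_of_mem _ (Finset.mem_univ i))
    exact ⟨n, by simpa using hn⟩
  choose z hz using hz
  obtain ⟨i, hi⟩ := Function.ne_iff.1 hx
  obtain ⟨y, hy, hgcd⟩ := Finset.extract_gcd z ⟨i, Finset.mem_univ i⟩
  set g := Finset.univ.gcd z
  have hzi : z i ≠ 0 := by
    have := hz i
    intro h
    rw [h, Int.cast_zero] at this
    exact (mul_ne_zero hb0 hi) this.symm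
  have hg : (g : ℚ) ≠ 0 := by
    intro h
    rw [hy i (Finset.mem_univ i), Int.cast_eq_zero.1 h, zero_mul] at hzi
    exact hzi rfl
  refine ⟨(b : ℤ) / g, y, div_ne_zero hb0 hg, hgcd, funext fun j => ?_⟩
  have h1 := hz j
  rw [hy j (Finset.mem_univ j), Int.cast_mul] at h1
  rw [Pi.smul_apply, smul_eq_mul, Function.comp_apply, div_mul_eq_mul_div, ← h1,
    mul_div_cancel_left₀ _ hg]

open Polynomial in
/-- A rational fraction is the quotient of two jointly primitive integral polynomials, and its
height is the logarithm of their largest coefficient. -/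
theorem RationalFraction.exists_integral_model (F : RatFunc ℚ) :
    ∃ (k : ℚ) (P Q : ℤ[X]) (M : ℕ), k ≠ 0 ∧ 1 ≤ M ∧
      P.map (Int.castRingHom ℚ) = C k * F.num ∧ Q.map (Int.castRingHom ℚ) = C k * F.denom ∧
      (∀ p : ℕ, p.Prime → ¬ (C (p : ℤ) ∣ P ∧ C (p : ℤ) ∣ Q)) ∧
      (∀ n, |P.coeff n| ≤ M) ∧ (∀ n, |Q.coeff n| ≤ M) ∧
      ((∃ n, |P.coeff n| = M) ∨ ∃ n, |Q.coeff n| = M) ∧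
      RationalFraction.height F = Real.log M := by
  have hx : coeffTuple F ≠ 0 := by
    intro h
    have := congrFun h (Sum.inr (Fin.last _))
    simp only [coeffTuple, Sum.elim_inr, Fin.val_last, Pi.zero_apply] at this
    exact F.denom_ne_zero (leadingCoeff_eq_zero.1 this)
  obtain ⟨k, y, hk, hgcd, hy⟩ := exists_smul_eq_intCast_gcd_eq_one hx
  have hlift : ∀ f : ℚ[X], (∀ n ≤ f.natDegree, ∃ m : ℤ, (m : ℚ) = k * f.coeff n) →
      ∃ G : ℤ[X], G.map (Int.castRingHom ℚ) = C k * f := by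
    intro f hf
    refine (mem_lifts _).1 ((lifts_iff_coeff_lifts _).2 fun n => ?_)
    rw [coeff_C_mul]
    rcases le_or_gt n f.natDegree with hn | hn
    · exact hf n hn
    · exact ⟨0, by simp [coeff_eq_zero_of_natDegree_lt hn]⟩
  have hyl : ∀ i : Fin (F.num.natDegree + 1), (y (Sum.inl i) : ℚ) = k * F.num.coeff i :=
    fun i => (congrFun hy (Sum.inl i)).symm
  have hyr : ∀ i : Fin (F.denom.natDegree + 1), (y (Sum.inr i) : ℚ) = k * F.denom.coeff i :=
    fun i => (congrFun hy (Sum.inr i)).symm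
  obtain ⟨P, hP⟩ := hlift F.num fun n hn => ⟨_, hyl ⟨n, Nat.lt_succ_of_le hn⟩⟩
  obtain ⟨Q, hQ⟩ := hlift F.denom fun n hn => ⟨_, hyr ⟨n, Nat.lt_succ_of_le hn⟩⟩
  have hPc : ∀ n, (P.coeff n : ℚ) = k * F.num.coeff n := fun n => by
    simpa using congrArg (coeff · n) hP
  have hQc : ∀ n, (Q.coeff n : ℚ) = k * F.denom.coeff n := fun n => by
    simpa using congrArg (coeff · n) hQ
  have hPy : ∀ i : Fin (F.num.natDegree + 1), y (Sum.inl i) = P.coeff i := fun i => by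
    exact_mod_cast (hyl i).trans (hPc i).symm
  have hQy : ∀ i : Fin (F.denom.natDegree + 1), y (Sum.inr i) = Q.coeff i := fun i => by
    exact_mod_cast (hyr i).trans (hQc i).symm
  have hle : ∀ i, |y i| ≤ ⨆ i, |y i| := fun i => Finite.le_ciSup (fun i => |y i|) i
  have hsup0 : 0 ≤ ⨆ i, |y i| := (abs_nonneg _).trans (hle (Sum.inr 0))
  obtain ⟨M, hM⟩ := Int.eq_ofNat_of_zero_le hsup0
  obtain ⟨i₀, hi₀⟩ := exists_eq_ciSup_of_finite (f := fun i => |y i|)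
  rw [hM] at hi₀ hle
  refine ⟨k, P, Q, M, hk, ?_, hP, hQ, ?_, ?_, ?_, ?_, ?_⟩
  · by_contra! h0
    have hzero : ∀ i, y i = 0 := fun i => by
      have := hle i
      have h0' : (M : ℤ) = 0 := by omega
      rw [h0'] at this
      exact abs_nonpos_iff.1 this
    rw [Finset.gcd_eq_zero_iff.2 fun i _ => hzero i] at hgcd
    exact zero_ne_one hgcd
  · rintro p hp ⟨h1, h2⟩
    rw [C_dvd_iff_dvd_coeff] at h1 h2
    have hdvd : (p : ℤ) ∣ Finset.univ.gcd y := Finset.dvd_gcd fun i _ => by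
      rcases i with i | i
      · rw [hPy]; exact h1 _
      · rw [hQy]; exact h2 _
    rw [hgcd] at hdvd
    exact hp.one_lt.ne' (by exact_mod_cast Int.eq_one_of_dvd_one (by positivity) hdvd)
  · intro n
    rcases le_or_gt n F.num.natDegree with hn | hn
    · exact (hPy ⟨n, Nat.lt_succ_of_le hn⟩) ▸ hle _
    · have : P.coeff n = 0 := by
        rw [← Int.cast_eq_zero (α := ℚ), hPc, coeff_eq_zero_of_natDegree_lt hn, mul_zero]
      simp [this]
  · intro n
    rcases le_or_gt n F.denom.natDegree with hn | hn
    · exact (hQy ⟨n, Nat.lt_succ_of_le hn⟩) ▸ hle _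
    · have : Q.coeff n = 0 := by
        rw [← Int.cast_eq_zero (α := ℚ), hQc, coeff_eq_zero_of_natDegree_lt hn, mul_zero]
      simp [this]
  · rcases i₀ with i | i
    · exact Or.inl ⟨i, hPy i ▸ hi₀⟩
    · exact Or.inr ⟨i, hQy i ▸ hi₀⟩
  · have : Nonempty (Fin (F.num.natDegree + 1) ⊕ Fin (F.denom.natDegree + 1)) := ⟨i₀⟩
    rw [RationalFraction.height, ← Height.logHeight_smul_eq_logHeight _ hk, hy,
      Rat.logHeight_eq_max_abs_of_gcd_eq_one hgcd, hM]
    simp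

/-- Both terms of a fraction are bounded by the height of the quotient times their greatest common
divisor. -/
theorem natAbs_le_mulHeight₁_mul_gcd (a : ℤ) {b : ℤ} (hb : b ≠ 0) :
    (a.natAbs : ℝ) ≤ Height.mulHeight₁ ((a : ℚ) / b) * Int.gcd a b ∧
      (b.natAbs : ℝ) ≤ Height.mulHeight₁ ((a : ℚ) / b) * Int.gcd a b := by
  set q : ℚ := (a : ℚ) / b with hq
  obtain ⟨c, hac, hbc⟩ := Rat.num_den_mk hb (show q = Rat.divInt a b by
    rw [Rat.divInt_eq_div])
  have hg : Int.gcd a b = c.natAbs := by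
    rw [hac, hbc, Int.gcd_mul_left]
    have : Int.gcd q.num q.den = 1 := q.reduced
    rw [this, mul_one]
  rw [Rat.mulHeight₁_eq_max, hg]
  constructor
  · have : a.natAbs ≤ max q.num.natAbs q.den * c.natAbs := by
      conv_lhs => rw [hac, Int.natAbs_mul, mul_comm]
      exact Nat.mul_le_mul_right _ (le_max_left _ _)
    exact_mod_cast this
  · have : b.natAbs ≤ max q.num.natAbs q.den * c.natAbs := by
      conv_lhs => rw [hbc, Int.natAbs_mul, mul_comm, Int.natAbs_natCast]
      exact Nat.mul_le_mul_right _ (le_max_right _ _)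
    exact_mod_cast this
-- Comparison of the two estimates for the product of gcds.
open Polynomial in
/-- Comparison of the largest coefficient of two jointly primitive polynomials with the heights of
the quotients of their values. -/
theorem exists_card_mul_log_sub_le {P Q : ℤ[X]} {d M N : ℕ} (hd : 1 ≤ d) (hM : 1 ≤ M)
    (hN : 1 ≤ N) (hPd : P.natDegree ≤ d) (hQd : Q.natDegree ≤ d)
    (hprim : ∀ p : ℕ, p.Prime → ¬ (C (p : ℤ) ∣ P ∧ C (p : ℤ) ∣ Q))
    (hcop : IsCoprime (P.map (Int.castRingHom ℚ)) (Q.map (Int.castRingHom ℚ)))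
    (hP : ∀ n, |P.coeff n| ≤ M) (hQ : ∀ n, |Q.coeff n| ≤ M)
    (hmax : (∃ n, |P.coeff n| = M) ∨ ∃ n, |Q.coeff n| = M)
    {S : Finset ℤ} (hS : S ⊆ Finset.Icc (1 : ℤ) N) {H : ℝ}
    (hH : ∀ x ∈ S, Q.eval x ≠ 0 ∧
      Height.logHeight₁ (((P.eval x : ℤ) : ℚ) / ((Q.eval x : ℤ) : ℚ)) ≤ H) :
    ∃ n : ℕ, S.card ≤ n + d ∧
      (n : ℝ) * (Real.log M - (Real.log (d + 1) + d * Real.log (N + 1) + H)) ≤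
        d * (2 * d * Real.log (2 * d) + 2 * d * Real.log M + 2 * (N * Real.log N)) := by
  obtain ⟨R, hR0, hRle, hRdvd⟩ := exists_gcd_eval_dvd hd hM hPd hQd hP hQ hcop
  -- `f` is whichever of `P`, `Q` attains `M`; the height of the quotient controls both.
  obtain ⟨f, n, hfd, hfn, hf⟩ : ∃ (f : ℤ[X]) (n : ℕ), f.natDegree ≤ d ∧ |f.coeff n| = M ∧
      ∀ x ∈ S, ((f.eval x).natAbs : ℝ) ≤ Real.exp H * Int.gcd (P.eval x) (Q.eval x) := by
    have hbound : ∀ x ∈ S, Height.mulHeight₁ (((P.eval x : ℤ) : ℚ) / ((Q.eval x : ℤ) : ℚ)) *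
        Int.gcd (P.eval x) (Q.eval x) ≤ Real.exp H * Int.gcd (P.eval x) (Q.eval x) :=
      fun x hx => mul_le_mul_of_nonneg_right
        ((Real.log_le_iff_le_exp (Height.mulHeight₁_pos _)).1 (hH x hx).2) (Nat.cast_nonneg _)
    rcases hmax with ⟨n, hn⟩ | ⟨n, hn⟩
    · exact ⟨P, n, hPd, hn, fun x hx =>
        (natAbs_le_mulHeight₁_mul_gcd _ (hH x hx).1).1.trans (hbound x hx)⟩
    · exact ⟨Q, n, hQd, hn, fun x hx =>
        (natAbs_le_mulHeight₁_mul_gcd _ (hH x hx).1).2.trans (hbound x hx)⟩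
  -- Discarding the at most `d` points where `f` is small leaves those with a large gcd.
  set G := S.filter fun x => ¬ ((d + 1) * ((N : ℤ) + 1) ^ d * |f.eval x| < M) with hG
  have hGS : G ⊆ S := Finset.filter_subset _ _
  have hMpos : (0 : ℝ) < M := by exact_mod_cast hM
  have hdpos : (0 : ℝ) < d := by exact_mod_cast hd
  have hgpos : ∀ x ∈ G, (0 : ℝ) < Int.gcd (P.eval x) (Q.eval x) := fun x hx => by
    exact_mod_cast Int.gcd_pos_of_ne_zero_right _ (hH x (hGS hx)).1
  refine ⟨G.card, ?_, ?_⟩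
  · have h1 := Finset.card_filter_add_card_filter_not (s := S)
      (fun x => (d + 1) * ((N : ℤ) + 1) ^ d * |f.eval x| < M)
    have h2 := card_filter_abs_eval_lt_le hfd hfn hS
    rw [← hG] at h1
    omega
  have hterm : ∀ x ∈ G, Real.log M - (Real.log (d + 1) + d * Real.log (N + 1) + H) ≤
      Real.log (Int.gcd (P.eval x) (Q.eval x)) := by
    intro x hx
    have h1 : (M : ℤ) ≤ (d + 1) * ((N : ℤ) + 1) ^ d * |f.eval x| :=
      not_lt.1 (Finset.mem_filter.1 hx).2
    have h2 : (M : ℝ) ≤ (d + 1) * ((N : ℝ) + 1) ^ d * (f.eval x).natAbs := by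
      rw [Nat.cast_natAbs]
      exact_mod_cast h1
    have h3 : (M : ℝ) ≤ (d + 1) * ((N : ℝ) + 1) ^ d *
        (Real.exp H * Int.gcd (P.eval x) (Q.eval x)) :=
      h2.trans (mul_le_mul_of_nonneg_left (hf x (hGS hx)) (by positivity))
    have h4 := Real.log_le_log hMpos h3
    have hg := hgpos x hx
    rw [Real.log_mul (by positivity) (by positivity), Real.log_mul (by positivity) (by positivity),
      Real.log_mul (by positivity) (by positivity), Real.log_pow, Real.log_exp] at h4
    linarith
  have hfac : ∀ k : ℕ, Real.log (k.factorial : ℝ) ≤ k * Real.log k := fun k => by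
    rw [← Real.log_pow]
    exact Real.log_le_log (by exact_mod_cast k.factorial_pos)
      (by exact_mod_cast Nat.factorial_le_pow k)
  have hRpos : (0 : ℝ) < R := by exact_mod_cast Nat.pos_of_ne_zero hR0
  have hlogR : Real.log R ≤ 2 * d * Real.log (2 * d) + 2 * d * Real.log M := by
    have h1 : (R : ℝ) ≤ (2 * d).factorial * (M : ℝ) ^ (2 * d) := by exact_mod_cast hRle
    have h2 := Real.log_le_log hRpos h1
    rw [Real.log_mul (by positivity) (by positivity), Real.log_pow] at h2
    have h3 := hfac (2 * d)
    push_cast at h2 h3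
    linarith
  have hprod : ∏ x ∈ G, Int.gcd (P.eval x) (Q.eval x) ≤ (R * (N.factorial) ^ 2) ^ d :=
    Nat.le_of_dvd (by positivity)
      (prod_gcd_eval_dvd hPd hQd hprim hR0 (hGS.trans hS) fun x _ => hRdvd x)
  have hlogprod : ∑ x ∈ G, Real.log (Int.gcd (P.eval x) (Q.eval x)) ≤
      d * (Real.log R + 2 * Real.log N.factorial) := by
    rw [← Real.log_prod fun x hx => (hgpos x hx).ne']
    have h1 : ∏ x ∈ G, (Int.gcd (P.eval x) (Q.eval x) : ℝ) ≤ (R * (N.factorial : ℝ) ^ 2) ^ d := by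
      exact_mod_cast hprod
    have h2 := Real.log_le_log (Finset.prod_pos hgpos) h1
    rw [Real.log_pow, Real.log_mul (by positivity) (by positivity), Real.log_pow] at h2
    exact_mod_cast h2
  calc (G.card : ℝ) * (Real.log M - (Real.log (d + 1) + d * Real.log (N + 1) + H))
      ≤ ∑ x ∈ G, Real.log (Int.gcd (P.eval x) (Q.eval x)) := by
        rw [← nsmul_eq_mul]
        exact Finset.card_nsmul_le_sum _ _ _ hterm
    _ ≤ d * (Real.log R + 2 * Real.log N.factorial) := hlogprod
    _ ≤ _ := by
        refine mul_le_mul_of_nonneg_left ?_ hdpos.le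
        have := hfac N
        linarith

/-! ### Numerical estimates and conclusion. -/

/-- After division by `d² v`, the left side has `10 h` and the right side at most `2 h`, so `8 h` is
bounded by the remaining terms. The final constants are generous: `2 log c` is used only through its
sign, and `1923` only through `34 ≤ 8 * 1923`. -/
theorem le_of_card_mul_sub_le {c d v n h : ℝ} (hc : 1 ≤ c) (hd : 1 ≤ d) (hv : 1 ≤ v)
    (hn : 10 * d ^ 2 * v ≤ n)
    (hle : n * (h - (Real.log (d + 1) + d * Real.log (12 * d ^ 2 * v + 1) +
        c * max 1 (d * Real.log d + d * Real.log (12 * d ^ 2 * v)))) ≤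
      d * (2 * d * Real.log (2 * d) + 2 * d * h +
        2 * (12 * d ^ 2 * v * Real.log (12 * d ^ 2 * v)))) :
    h ≤ ((4 * c + 1923) * (12 + Real.log v + 2 * Real.log c)) * d * Real.log (4 * d) := by
  have hd0 : 0 < d := by linarith
  have hv0 : 0 < v := by linarith
  have hl : 0 ≤ Real.log d := Real.log_nonneg hd
  have hw : 0 ≤ Real.log v := Real.log_nonneg hv
  have hcl : 0 ≤ Real.log c := Real.log_nonneg hc
  have h2lt := Real.log_two_lt_d9
  have h2gt := Real.log_two_gt_d9
  have hsq : 1 ≤ d ^ 2 := one_le_pow₀ hd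
  have hdv : 1 ≤ d ^ 2 * v := one_le_mul_of_one_le_of_one_le hsq hv
  have h4 : Real.log (4 * d) = 2 * Real.log 2 + Real.log d := by
    rw [Real.log_mul (by norm_num) hd0.ne', show (4 : ℝ) = 2 ^ 2 by norm_num, Real.log_pow]
    norm_num
  have h2d : Real.log (2 * d) = Real.log 2 + Real.log d :=
    Real.log_mul (by norm_num) hd0.ne'
  have h12 : Real.log 12 ≤ 4 * Real.log 2 := by
    have : Real.log 12 ≤ Real.log (2 ^ 4) := Real.log_le_log (by norm_num) (by norm_num)
    rwa [Real.log_pow] at this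
  have hlam : Real.log (12 * d ^ 2 * v) = Real.log 12 + 2 * Real.log d + Real.log v := by
    rw [Real.log_mul (by positivity) hv0.ne', Real.log_mul (by norm_num) (by positivity),
      Real.log_pow]
    norm_num
  have hlam0 : 0 ≤ Real.log (12 * d ^ 2 * v) := Real.log_nonneg (by nlinarith)
  have hN1 : Real.log (12 * d ^ 2 * v + 1) ≤ Real.log 2 + Real.log (12 * d ^ 2 * v) := by
    rw [← Real.log_mul (by norm_num) (by positivity)]
    exact Real.log_le_log (by positivity) (by nlinarith)
  have hd1 : Real.log (d + 1) ≤ Real.log 2 + Real.log d := by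
    rw [← h2d]
    exact Real.log_le_log (by positivity) (by linarith)
  have hd10 : 0 ≤ Real.log (d + 1) := Real.log_nonneg (by linarith)
  have hN10 : 0 ≤ Real.log (12 * d ^ 2 * v + 1) := Real.log_nonneg (by nlinarith)
  have hmaxle : max 1 (d * Real.log d + d * Real.log (12 * d ^ 2 * v)) ≤
      d * (1 + Real.log d + Real.log (12 * d ^ 2 * v)) := by
    refine max_le ?_ ?_ <;> nlinarith [mul_nonneg hd0.le hl, mul_nonneg hd0.le hlam0]
  rw [h2d] at hle
  set L := Real.log (12 * d ^ 2 * v)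
  set l := Real.log d
  set w := Real.log v
  set A := Real.log (d + 1) + d * Real.log (12 * d ^ 2 * v + 1) + c * max 1 (d * l + d * L)
    with hA
  have hA0 : 0 ≤ A := by
    have : 0 ≤ max 1 (d * l + d * L) := zero_le_one.trans (le_max_left _ _)
    have := mul_nonneg (zero_le_one.trans hc) this
    have := mul_nonneg hd0.le hN10
    linarith
  have hAle : A ≤ d * ((Real.log 2 + l) + (Real.log 2 + L) + c * (1 + l + L)) := by
    have e1 := mul_le_mul_of_nonneg_left hmaxle (zero_le_one.trans hc)
    have e2 := mul_le_mul_of_nonneg_left hN1 hd0.le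
    have e3 : Real.log 2 + l ≤ d * (Real.log 2 + l) := le_mul_of_one_le_left (by linarith) hd
    nlinarith
  have hmain : 8 * h ≤ 10 * A + 2 * (Real.log 2 + l) + 24 * (d * L) := by
    have hdL := mul_nonneg hd0.le hlam0
    -- Replacing `n` by `10 d² v` requires `h - A ≥ 0`; otherwise the bound is immediate.
    by_cases hcase : h ≤ A
    · linarith
    · have hpos : 0 ≤ h - A := by linarith
      have e1 := (mul_le_mul_of_nonneg_right hn hpos).trans hle
      have e2 : 2 * (Real.log 2 + l + h) ≤ v * (2 * (Real.log 2 + l + h)) :=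
        le_mul_of_one_le_left (by linarith) hv
      have e3 := mul_le_mul_of_nonneg_left e2 (zero_le_one.trans hsq)
      have e4 : (d ^ 2 * v) * (10 * (h - A)) ≤
          (d ^ 2 * v) * (2 * (Real.log 2 + l + h) + 24 * (d * L)) := by
        linarith
      have := le_of_mul_le_mul_left e4 (by linarith)
      linarith
  have hbound : 8 * h ≤ d * (111 + 80 * l + 34 * w + 10 * c * (4 + 3 * l + w)) := by
    have e1 : 2 * (Real.log 2 + l) ≤ d * (2 * (Real.log 2 + l)) :=
      le_mul_of_one_le_left (by linarith) hd
    have hL : L ≤ 2.8 + 2 * l + w := by linarith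
    have e2 : c * (1 + l + L) ≤ c * (4 + 3 * l + w) :=
      mul_le_mul_of_nonneg_left (by linarith) (zero_le_one.trans hc)
    have e3 : 10 * ((Real.log 2 + l) + (Real.log 2 + L) + c * (1 + l + L)) +
        2 * (Real.log 2 + l) + 24 * L ≤ 111 + 80 * l + 34 * w + 10 * c * (4 + 3 * l + w) := by
      linarith
    have e4 := mul_le_mul_of_nonneg_left e3 hd0.le
    linarith
  rw [h4]
  set X := (12 + w) * (2 * Real.log 2 + l) with hX
  have hwl : 0 ≤ w * l := mul_nonneg hw hl
  have hX1 : 12 + 12 * l + w ≤ X := by nlinarith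
  have hX0 : 0 ≤ X := by linarith
  have hXle : X ≤ (12 + w + 2 * Real.log c) * (2 * Real.log 2 + l) :=
    mul_le_mul_of_nonneg_right (by linarith) (by linarith)
  have hfin : 111 + 80 * l + 34 * w + 10 * c * (4 + 3 * l + w) ≤ 8 * ((4 * c + 1923) * X) := by
    have e1 : c * (4 + 3 * l + w) ≤ c * X :=
      mul_le_mul_of_nonneg_left (by linarith) (zero_le_one.trans hc)
    have e2 : 0 ≤ c * X := mul_nonneg (zero_le_one.trans hc) hX0
    linarith
  have e1 := mul_le_mul_of_nonneg_left
    (mul_le_mul_of_nonneg_left hXle (show 0 ≤ 4 * c + 1923 by linarith)) hd0.le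
  have e2 := mul_le_mul_of_nonneg_left hfin hd0.le
  linarith

theorem corollary1p3 (c : ℝ) (hc : 1 ≤ c) (d : ℕ) (hd : 1 ≤ d)
    (F : RatFunc ℚ) (hF : RationalFraction.degree F ≤ d)
    (V : Finset ℤ)
    (hV : ∀ x : ℤ, x ∉ V → ¬ RationalFraction.IsPole F (x : ℚ))
    (hval : ∀ x : ℤ, x ∉ V →
      Height.logHeight₁ (RationalFraction.value F (x : ℚ)) ≤
        c * max 1 ((d : ℝ) * Real.log (d : ℝ) + (d : ℝ) * Height.logHeight₁ (x : ℚ))) :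
    RationalFraction.height F ≤
      ((4 * c + 1923) * (12 + Real.log (max 1 (V.card : ℝ)) + 2 * Real.log c)) *
        (d : ℝ) * Real.log (4 * (d : ℝ)) := by
  obtain ⟨k, P, Q, M, hk, hM, hPF, hQF, hprim, hP, hQ, hmax, hheight⟩ :=
    RationalFraction.exists_integral_model F
  have hinj : Function.Injective (Int.castRingHom ℚ) := Int.cast_injective
  have hPd : P.natDegree ≤ d := by
    rw [← Polynomial.natDegree_map_eq_of_injective hinj, hPF, Polynomial.natDegree_C_mul hk]
    exact (le_max_left _ _).trans hF
  have hQd : Q.natDegree ≤ d := by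
    rw [← Polynomial.natDegree_map_eq_of_injective hinj, hQF, Polynomial.natDegree_C_mul hk]
    exact (le_max_right _ _).trans hF
  have hcop : IsCoprime (P.map (Int.castRingHom ℚ)) (Q.map (Int.castRingHom ℚ)) := by
    have hu : IsUnit (Polynomial.C k) := Polynomial.isUnit_C.2 hk.isUnit
    rw [hPF, hQF, isCoprime_mul_unit_left hu]
    exact F.isCoprime_num_denom
  have hPx : ∀ x : ℤ, ((P.eval x : ℤ) : ℚ) = k * F.num.eval (x : ℚ) := fun x => by
    have := congrArg (Polynomial.eval (x : ℚ)) hPF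
    rwa [Polynomial.eval_intCast_map, Polynomial.eval_mul, Polynomial.eval_C] at this
  have hQx : ∀ x : ℤ, ((Q.eval x : ℤ) : ℚ) = k * F.denom.eval (x : ℚ) := fun x => by
    have := congrArg (Polynomial.eval (x : ℚ)) hQF
    rwa [Polynomial.eval_intCast_map, Polynomial.eval_mul, Polynomial.eval_C] at this
  have hd2 : 1 ≤ d ^ 2 := Nat.one_le_pow _ _ hd
  set v : ℕ := max 1 V.card with hv
  have hv1 : 1 ≤ v := le_max_left _ _
  -- Of these `12 d² v` integers, `V` removes at most `d² v` and the small values of `f` at most `d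
  -- ≤ d² v`, leaving `10 d² v`. Taking `v ≥ 1` covers empty `V`.
  set N : ℕ := 12 * d ^ 2 * v with hN
  have hdv : d ≤ d ^ 2 * v := (Nat.le_self_pow two_ne_zero d).trans (Nat.le_mul_of_pos_right _ hv1)
  have hVv : V.card ≤ d ^ 2 * v :=
    (le_max_right _ _).trans (Nat.le_mul_of_pos_left _ hd2)
  have hNeq : N = 12 * (d ^ 2 * v) := by rw [hN, mul_assoc]
  have hN1 : 1 ≤ N := by omega
  set S : Finset ℤ := Finset.Icc (1 : ℤ) N \ V with hS
  have hScard : N ≤ S.card + V.card := by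
    have h1 := Finset.le_card_sdiff V (Finset.Icc (1 : ℤ) N)
    rw [Int.card_Icc, ← hS] at h1
    omega
  obtain ⟨n, hn, hle⟩ := exists_card_mul_log_sub_le hd hM hN1 hPd hQd hprim hcop hP hQ hmax
    (S := S) Finset.sdiff_subset
    (H := c * max 1 ((d : ℝ) * Real.log d + d * Real.log N)) (by
      intro x hx
      obtain ⟨hxI, hxV⟩ := Finset.mem_sdiff.1 hx
      obtain ⟨hx1, hxN⟩ := Finset.mem_Icc.1 hxI
      refine ⟨fun h0 => hV x hxV ?_, ?_⟩
      · have := hQx x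
        rw [h0, Int.cast_zero] at this
        exact (mul_eq_zero.1 this.symm).resolve_left hk
      · have hq : ((P.eval x : ℤ) : ℚ) / ((Q.eval x : ℤ) : ℚ) = RationalFraction.value F x := by
          rw [hPx, hQx, mul_div_mul_left _ _ hk]
          rfl
        rw [hq]
        refine (hval x hxV).trans (mul_le_mul_of_nonneg_left ?_ (zero_le_one.trans hc))
        refine max_le_max le_rfl (add_le_add le_rfl (mul_le_mul_of_nonneg_left ?_ (Nat.cast_nonneg _)))
        obtain ⟨m, rfl⟩ := Int.eq_ofNat_of_zero_le (zero_le_one.trans hx1)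
        have hm1 : 1 ≤ m := by exact_mod_cast hx1
        have : NeZero m := ⟨by omega⟩
        rw [Int.cast_natCast, Rat.logHeight₁_natCast]
        exact Real.log_le_log (by exact_mod_cast hm1) (by exact_mod_cast hxN))
  have hn10 : 10 * d ^ 2 * v ≤ n := by
    rw [mul_assoc]
    omega
  have hvcast : (v : ℝ) = max 1 (V.card : ℝ) := by rw [hv]; push_cast; rfl
  have hNcast : (N : ℝ) = 12 * (d : ℝ) ^ 2 * v := by rw [hN]; push_cast; ring
  rw [hheight, ← hvcast]
  rw [hNcast] at hle
  exact le_of_card_mul_sub_le hc (by exact_mod_cast hd) (by exact_mod_cast hv1)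
    (by exact_mod_cast hn10) hle
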